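/- For $a\in\mathbb{C}$ and $t\in\mathbb{R}$ let $H_t(a)$ be the operator generated in $L_2[0,\pi]$ by the differential expression $-y''(x)+2a\cos(2x)\,y(x)$ and the boundary conditions $y(\pi)=e^{it}y(0)$, $y'(\pi)=e^{it}y'(0)$; its domain consists of the functions $y$ with $y,y'$ absolutely continuous on $[0,\pi]$ and $y''\in L_2[0,\pi]$ that satisfy the boundary conditions. Let $I(2)=\{ix: x\in(0,2)\}$. Let $n\ge 1$ be an integer with $n\neq 2$, and for $a\in I(2)$ consider the eigenvalues of $H_0(a)$ if $n$ is even, and of $H_\pi(a)$ if $n$ is odd, that lie in the closed disc $\{\lambda\in\mathbb{C}:|\lambda-n^2|\le 4\}$. For every $a\in I(2)$ there are exactly two such eigenvalues, and they are either two distinct real numbers or two nonreal complex conjugate numbers. Denote them by $\lambda_n^-(a)$ and $\lambda_n^+(a)$, where $\lambda_n^-(a)<\lambda_n^+(a)$ in the first case and $\operatorname{Im}\lambda_n^-(a)<0<\operatorname{Im}\lambda_n^+(a)$ in the second. Then $\lambda_n^-(a)$ is real for all $a\in I(2)$ if and only if there exists $b\in I(2)$ such that $\lambda_n^-(b)$ is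 real, and $\lambda_n^-(a)$ is nonreal for all $a\in I(2)$ if and only if there exists $b\in I(2)$ such that $\lambda_n^-(b)$ is nonreal. Both statements continue to hold if $\lambda_n^-$ is replaced by $\lambda_n^+$. -/

import Mathlib

noncomputable section

namespace MathieuOp

open MeasureTheory

/-- The potential `a e^{-2ix} + a e^{2ix} = 2a cos 2x`. -/
def potential (a : ℂ) (x : ℝ) : ℂ :=
  a * Complex.exp (-(2 * x * Complex.I)) + a * Complex.exp (2 * x * Complex.I)

/-- The graph of the operator `H_t(a)` generated in `L²[0,π]` by `-y'' + q y`, `q = 2a cos 2x`,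
and the boundary conditions `y(π) = e^{it} y(0)`, `y'(π) = e^{it} y'(0)`: here `y` belongs to the
domain of `H_t(a)` (`y` and `y'` are absolutely continuous on `[0,π]` and `y''` is in `L²[0,π]`,
which is written through integrals with `dy = y'` and `d2y = y''`), and `H_t(a) y = f` almost
everywhere on `[0,π]`. Only the values on `[0,π]` matter. -/
def IsImage (t : ℝ) (a : ℂ) (y f : ℝ → ℂ) : Prop :=
  ∃ dy d2y : ℝ → ℂ,
    MemLp d2y 2 (volume.restrict (Set.Icc 0 Real.pi)) ∧
    (∀ x ∈ Set.Icc 0 Real.pi, y x = y 0 + ∫ s in (0 : ℝ)..x, dy s) ∧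
    (∀ x ∈ Set.Icc 0 Real.pi, dy x = dy 0 + ∫ s in (0 : ℝ)..x, d2y s) ∧
    y Real.pi = Complex.exp (Complex.I * t) * y 0 ∧
    dy Real.pi = Complex.exp (Complex.I * t) * dy 0 ∧
    ∀ᵐ x ∂(volume.restrict (Set.Icc 0 Real.pi)), -d2y x + potential a x * y x = f x

/-- `l` is an eigenvalue of `H_t(a)`: it has an eigenfunction in the domain of the operator that
is not the zero function (a function in the domain is continuous on `[0,π]`, so it is zero in
`L²[0,π]` if and only if it vanishes at every point of `[0,π]`). -/
def IsEigenvalue (t : ℝ) (a l : ℂ) : Prop :=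
  ∃ y : ℝ → ℂ, (∃ x ∈ Set.Icc 0 Real.pi, y x ≠ 0) ∧ IsImage t a y (fun x => l * y x)

/-- The eigenvalues in the closed disc `D_4(n²)` of the periodic operator `H_0(a)` when `n` is
even, and of the antiperiodic operator `H_π(a)` when `n` is odd. -/
def eigenvaluesInDisc (n : ℕ) (a : ℂ) : Set ℂ :=
  {l | IsEigenvalue (if Even n then 0 else Real.pi) a l ∧
    l ∈ Metric.closedBall ((n : ℂ) ^ 2) 4}

/-- `p = (λ_n^-(a), λ_n^+(a))`: the eigenvalues in the disc are exactly `p.1` and `p.2`, which are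
either real with `p.1 < p.2`, or nonreal and conjugate with `Im p.1 < 0 < Im p.2`. -/
def IsEigenPair (n : ℕ) (a : ℂ) (p : ℂ × ℂ) : Prop :=
  eigenvaluesInDisc n a = {p.1, p.2} ∧
    ((p.1.im = 0 ∧ p.2.im = 0 ∧ p.1.re < p.2.re) ∨
      (p.1.im < 0 ∧ 0 < p.2.im ∧ p.2 = starRingEnd ℂ p.1))

/-- There is at most one such pair, so that the choice below is no choice. -/
theorem IsEigenPair.unique {n : ℕ} {a : ℂ} {p q : ℂ × ℂ} (hp : IsEigenPair n a p)
    (hq : IsEigenPair n a q) : p = q := by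
  obtain ⟨hp1, hp2⟩ := hp
  obtain ⟨hq1, hq2⟩ := hq
  have h : ({p.1, p.2} : Set ℂ) = {q.1, q.2} := hp1.symm.trans hq1
  rcases Set.pair_eq_pair_iff.1 h with ⟨h1, h2⟩ | ⟨h1, h2⟩
  · exact Prod.ext h1 h2
  · exfalso
    rw [h1, h2] at hp2
    rcases hp2 with ⟨h3, h4, h5⟩ | ⟨h3, h4, -⟩ <;>
      rcases hq2 with ⟨h6, h7, h8⟩ | ⟨h6, h7, -⟩ <;> linarith

/-- `(λ_n^-(a), λ_n^+(a))`. -/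
def eigenPair (n : ℕ) (a : ℂ) : ℂ × ℂ :=
  Classical.epsilon (IsEigenPair n a)

/-- `λ_n^-(a)`. -/
def lamMinus (n : ℕ) (a : ℂ) : ℂ := (eigenPair n a).1

/-- `λ_n^+(a)`. -/
def lamPlus (n : ℕ) (a : ℂ) : ℂ := (eigenPair n a).2

/-- The open segment `I(c) = {ix : 0 < x < c}` of the imaginary axis. -/
def imagSegment (c : ℝ) : Set ℂ :=
  {a | ∃ x : ℝ, 0 < x ∧ x < c ∧ a = Complex.I * x}

end MathieuOp

end

/-! Whether the two eigenvalues are real depends only on the parity of `n`: they are real for even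
`n` and nonreal for odd `n`, for every `a` in the segment. The equivalences follow at once.

Expand an eigenfunction as `∑ c k * exp (i (n + 2k) x)`; the equation becomes the three-term
recursion `HillEq`. For `l` in the disc its diagonal has modulus at least `4 > 2‖a‖` except at `k =
0` and `k = -n`, so a bounded solution is determined by its values there. The reflection `k ↦ -n -
k` (that is, `x ↦ -x`) splits solutions into parities `σ = ±1`. With `c 0 = 1`, what remains is the
scalar equation `l = n ^ 2 + shift a c`, where `c` depends on `l`. Its right side is a contraction
with constant `7 / 9` (`IsReduced.shift_lipschitz`), so each parity has exactly one eigenvalue in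
the disc (`existsUnique_hillSolution`). The two differ, since a common one would give two
independent decaying solutions of the recursion (`not_hillSolution_both`).

For imaginary `a`, the map `c k ↦ (-1) ^ k * conj (c k)` sends solutions for `l` to solutions for
`conj l` and multiplies the parity by `(-1) ^ n` (`IsHillSolution.conj`). For even `n` each
eigenvalue is therefore its own conjugate; for odd `n` the two distinct eigenvalues are conjugate to
each other, hence nonreal. -/

noncomputable section

namespace MathieuOp

open MeasureTheory

/-! ### Three-term recursions with dominant diagonal -/

/-- A maximum principle for three-term recursions with a dominant diagonal off a set `E`. -/
theorem norm_le_of_recursion {d c : ℤ → ℂ} {a : ℂ} {E : Set ℤ} {δ B M : ℝ}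
    (hδ : 2 * ‖a‖ < δ) (hd : ∀ k ∉ E, δ ≤ ‖d k‖)
    (hc : ∀ k ∉ E, d k * c k = a * (c (k - 1) + c (k + 1)))
    (hM : ∀ k, ‖c k‖ ≤ M) (hB : 0 ≤ B) (hE : ∀ k ∈ E, ‖c k‖ ≤ B) (k : ℤ) : ‖c k‖ ≤ B := by
  have hbdd : BddAbove (Set.range fun k => ‖c k‖) := ⟨M, by rintro _ ⟨k, rfl⟩; exact hM k⟩
  have hs : ∀ k, ‖c k‖ ≤ ⨆ k, ‖c k‖ := fun k => le_ciSup hbdd k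
  set s := ⨆ k, ‖c k‖ with hsdef
  by_contra! hk
  have hBs : B < s := hk.trans_le (hs k)
  have ha := norm_nonneg a
  have hδ0 : 0 < δ := by linarith
  -- The supremum need not be attained, so every term is bounded: off `E` by `2‖a‖s/δ`, which is
  -- less than `s`.
  have h1 : s ≤ max B (2 * ‖a‖ * s / δ) := by
    refine ciSup_le fun j => ?_
    by_cases hj : j ∈ E
    · exact (hE j hj).trans (le_max_left _ _)
    · refine le_max_of_le_right ?_
      rw [le_div_iff₀ hδ0]
      have h2 : ‖d j‖ * ‖c j‖ ≤ ‖a‖ * (s + s) := by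
        rw [← norm_mul, hc j hj, norm_mul]
        gcongr
        exact (norm_add_le _ _).trans (add_le_add (hs _) (hs _))
      nlinarith [hd j hj, norm_nonneg (c j)]
  have h3 : 2 * ‖a‖ * s / δ < s := by
    rw [div_lt_iff₀ hδ0]; nlinarith
  exact absurd h1 (not_le.2 (max_lt hBs h3))

/-- Solvability of such a recursion with prescribed values on `E`. -/
theorem exists_bounded_solution {d b : ℤ → ℂ} {a : ℂ} {E : Set ℤ} {δ : ℝ}
    (hδ : 2 * ‖a‖ < δ) (hd : ∀ k ∉ E, δ ≤ ‖d k‖) (hb : ∀ k, ‖b k‖ ≤ 1) :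
    ∃ c : ℤ → ℂ, (∃ M, ∀ k, ‖c k‖ ≤ M) ∧ (∀ k ∈ E, c k = b k) ∧
      ∀ k ∉ E, d k * c k = a * (c (k - 1) + c (k + 1)) := by
  classical
  have ha := norm_nonneg a
  have hδ0 : 0 < δ := by linarith
  -- Solutions are the fixed points of `F`, a contraction in the sup norm with constant `2‖a‖/δ <
  -- 1`.
  let F : (ℤ → ℂ) → ℤ → ℂ := fun c k => if k ∈ E then b k else a * (c (k - 1) + c (k + 1)) / d k
  have key : ∀ u v : ℤ → ℂ, ∀ C, (∀ k, ‖u k - v k‖ ≤ C) → 0 ≤ C →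
      ∀ k, ‖F u k - F v k‖ ≤ 2 * ‖a‖ / δ * C := by
    intro u v C hC hC0 k
    by_cases hk : k ∈ E
    · simp only [F, if_pos hk, sub_self, norm_zero]; positivity
    · simp only [F, if_neg hk, ← sub_div, norm_div]
      rw [← mul_sub, norm_mul, div_le_iff₀ (hδ0.trans_le (hd k hk))]
      have h1 : ‖u (k - 1) + u (k + 1) - (v (k - 1) + v (k + 1))‖ ≤ C + C := by
        rw [add_sub_add_comm]
        exact (norm_add_le _ _).trans (add_le_add (hC _) (hC _))
      calc ‖a‖ * _ ≤ ‖a‖ * (C + C) := by gcongr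
        _ = 2 * ‖a‖ / δ * C * δ := by field_simp; ring
        _ ≤ _ := by gcongr; exact hd k hk
  have hF0 : ∀ k, ‖F 0 k‖ ≤ 1 := by
    intro k
    by_cases hk : k ∈ E
    · simpa [F, hk] using hb k
    · simp [F, hk]
  have hbd : ∀ c : BoundedContinuousFunction ℤ ℂ, ∀ k, ‖F c k‖ ≤ 2 * ‖a‖ / δ * ‖c‖ + 1 := by
    intro c k
    have := key c 0 ‖c‖ (fun k => by simpa using c.norm_coe_le_norm k) (norm_nonneg _) k
    calc ‖F c k‖ = ‖(F c k - F 0 k) + F 0 k‖ := by ring_nf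
      _ ≤ _ := (norm_add_le _ _).trans (add_le_add this (hF0 k))
  let T : BoundedContinuousFunction ℤ ℂ → BoundedContinuousFunction ℤ ℂ := fun c =>
    BoundedContinuousFunction.ofNormedAddCommGroupDiscrete (F c) _ (hbd c)
  obtain ⟨κ, hκ⟩ : ∃ κ : NNReal, (κ : ℝ) = 2 * ‖a‖ / δ := ⟨⟨_, by positivity⟩, rfl⟩
  have hT : ContractingWith κ T := by
    constructor
    · rw [← NNReal.coe_lt_coe, hκ]
      exact (div_lt_one hδ0).2 hδ
    · refine LipschitzWith.of_dist_le_mul fun u v => ?_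
      refine (BoundedContinuousFunction.dist_le (by positivity)).2 fun k => ?_
      rw [dist_eq_norm, hκ]
      exact key u v _ (fun j => by rw [← dist_eq_norm]; exact u.dist_coe_le_dist j) dist_nonneg k
  obtain ⟨c, hc⟩ : ∃ c, T c = c := ⟨_, hT.fixedPoint_isFixedPt⟩
  have hck : ∀ k, F c k = c k := fun k => DFunLike.congr_fun hc k
  refine ⟨c, ⟨_, c.norm_coe_le_norm⟩, fun k hk => ?_, fun k hk => ?_⟩
  · rw [← hck]
    simp [F, hk]
  · have hdk : d k ≠ 0 := norm_pos_iff.1 (hδ0.trans_le (hd k hk))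
    rw [← hck k]
    simp only [F, if_neg hk]
    field_simp

/-! ### The Fourier recursion and its reduced solutions -/

/-- The recursion for the coefficients of `∑ c k * exp (i (n + 2k) x)` which expresses
`-y'' + 2a cos 2x y = l y`. -/
def HillEq (n : ℕ) (a l : ℂ) (c : ℤ → ℂ) (k : ℤ) : Prop :=
  (l - ((n : ℂ) + 2 * k) ^ 2) * c k = a * (c (k - 1) + c (k + 1))

/-- A solution of the recursion at all indices except the two, `0` and `-n`, that belong to the
frequencies `n` and `-n`; it has parity `σ` with respect to the reflection that exchanges them. -/
structure IsReduced (n : ℕ) (a l σ : ℂ) (c : ℤ → ℂ) : Prop where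
  le_one : ∀ k : ℤ, ‖c k‖ ≤ 1
  zero : c 0 = 1
  symm : ∀ k : ℤ, c (-n - k) = σ * c k
  eq : ∀ k : ℤ, k ≠ 0 → k ≠ -n → HillEq n a l c k

/-- Since `(n + 2k) ^ 2 - n ^ 2 = 4k(k + n)`, this is the reverse triangle inequality. -/
theorem le_norm_diag_of_gap {n : ℕ} {l : ℂ} {r w : ℝ} (hl : ‖l - (n : ℂ) ^ 2‖ ≤ r) {k : ℤ}
    {g : ℤ} (hg : g ≤ |k * (k + n)|) (hw : w + r ≤ 4 * g) :
    w ≤ ‖l - ((n : ℂ) + 2 * k) ^ 2‖ := by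
  have h1 : 4 * |(k : ℝ) * (k + n)| = ‖((n : ℂ) + 2 * k) ^ 2 - (n : ℂ) ^ 2‖ := by
    have : ((n : ℂ) + 2 * k) ^ 2 - (n : ℂ) ^ 2 = ((4 * (k * (k + n)) : ℝ) : ℂ) := by
      push_cast; ring
    rw [this, Complex.norm_real, Real.norm_eq_abs, abs_mul]
    norm_num
  have h2 : (g : ℝ) ≤ |(k : ℝ) * (k + n)| := by exact_mod_cast hg
  have h3 := norm_sub_norm_le (((n : ℂ) + 2 * k) ^ 2 - (n : ℂ) ^ 2) (l - (n : ℂ) ^ 2)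
  rw [sub_sub_sub_cancel_right, norm_sub_rev _ l] at h3
  linarith

/-- For `n = 2` the index `k = -1`, of frequency zero, would give only `1`. -/
theorem two_le_gap {n : ℕ} (hn : 1 ≤ n) (hn2 : n ≠ 2) {k : ℤ} (h0 : k ≠ 0) (h1 : k ≠ -n) :
    2 ≤ |k * (k + n)| := by
  have hn' : (1 : ℤ) ≤ n := by exact_mod_cast hn
  have hn2' : (n : ℤ) ≠ 2 := by exact_mod_cast hn2
  generalize (n : ℤ) = N at *
  rw [le_abs]
  rcases lt_or_gt_of_ne h0 with h | h
  · rcases lt_or_gt_of_ne h1 with h' | h'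
    · left; nlinarith
    · right
      have : 3 ≤ N := by omega
      nlinarith
  · left; nlinarith

theorem three_le_gap {n : ℕ} (hn : 4 ≤ n) {k : ℤ} (h0 : k ≠ 0) (h1 : k ≠ -n) :
    3 ≤ |k * (k + n)| := by
  have hn' : (4 : ℤ) ≤ n := by exact_mod_cast hn
  generalize (n : ℤ) = N at *
  rw [le_abs]
  rcases lt_or_gt_of_ne h0 with h | h
  · rcases lt_or_gt_of_ne h1 with h' | h'
    · left; nlinarith
    · right; nlinarith
  · left; nlinarith

theorem four_le_diag {n : ℕ} (hn : 1 ≤ n) (hn2 : n ≠ 2) {l : ℂ} (hl : ‖l - (n : ℂ) ^ 2‖ ≤ 4)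
    {k : ℤ} (h0 : k ≠ 0) (h1 : k ≠ -n) : 4 ≤ ‖l - ((n : ℂ) + 2 * k) ^ 2‖ :=
  le_norm_diag_of_gap hl (two_le_gap hn hn2 h0 h1) (by norm_num)

/-- A bounded solution off `0` and `-n` is determined by its values there. -/
theorem eq_of_hillEq {n : ℕ} (hn : 1 ≤ n) (hn2 : n ≠ 2) {a l : ℂ} (ha : ‖a‖ < 2)
    (hl : ‖l - (n : ℂ) ^ 2‖ ≤ 4) {c e : ℤ → ℂ} {M M' : ℝ} (hM : ∀ k, ‖c k‖ ≤ M)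
    (hM' : ∀ k, ‖e k‖ ≤ M') (hc : ∀ k : ℤ, k ≠ 0 → k ≠ -n → HillEq n a l c k)
    (he : ∀ k : ℤ, k ≠ 0 → k ≠ -n → HillEq n a l e k) (h0 : c 0 = e 0) (h1 : c (-n) = e (-n)) :
    c = e := by
  funext k
  have := norm_le_of_recursion (d := fun k : ℤ => l - ((n : ℂ) + 2 * k) ^ 2)
    (c := fun k => c k - e k) (a := a) (E := {0, -(n : ℤ)}) (δ := 4) (B := 0) (M := M + M')
    (by linarith) (fun k hk => by
      simp only [Set.mem_insert_iff, Set.mem_singleton_iff, not_or] at hk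
      exact four_le_diag hn hn2 hl hk.1 hk.2) (fun k hk => by
      simp only [Set.mem_insert_iff, Set.mem_singleton_iff, not_or] at hk
      have h1 := hc k hk.1 hk.2
      have h2 := he k hk.1 hk.2
      simp only [HillEq] at h1 h2
      rw [mul_sub, h1, h2]; ring)
    (fun k => (norm_sub_le _ _).trans (add_le_add (hM k) (hM' k))) le_rfl (by
      rintro k (rfl | rfl)
      · simp [h0]
      · simp [h1]) k
  simpa [sub_eq_zero] using this

theorem HillEq.reflect {n : ℕ} {a l : ℂ} {c : ℤ → ℂ} {k : ℤ} (h : HillEq n a l c (-n - k)) :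
    HillEq n a l (fun j => c (-n - j)) k := by
  simp only [HillEq] at h ⊢
  rw [show (-(n : ℤ) - (k - 1)) = -n - k + 1 by ring, show (-(n : ℤ) - (k + 1)) = -n - k - 1 by ring,
    add_comm (c _), ← h]
  push_cast; ring

theorem HillEq.const_mul {n : ℕ} {a l : ℂ} {c : ℤ → ℂ} {k : ℤ} (h : HillEq n a l c k) (s : ℂ) :
    HillEq n a l (fun j => s * c j) k := by
  simp only [HillEq] at h ⊢
  linear_combination s * h

theorem HillEq.add {n : ℕ} {a l : ℂ} {c e : ℤ → ℂ} {k : ℤ} (h : HillEq n a l c k)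
    (h' : HillEq n a l e k) : HillEq n a l (fun j => c j + e j) k := by
  simp only [HillEq] at h h' ⊢
  linear_combination h + h'

/-- The normalized solution of parity `σ`. -/
theorem exists_isReduced {n : ℕ} (hn : 1 ≤ n) (hn2 : n ≠ 2) {a l σ : ℂ} (ha : ‖a‖ < 2)
    (hl : ‖l - (n : ℂ) ^ 2‖ ≤ 4) (hσ : σ ^ 2 = 1) : ∃ c, IsReduced n a l σ c := by
  have hσ1 : ‖σ‖ = 1 := by
    have : ‖σ‖ ^ 2 = 1 := by rw [← norm_pow, hσ, norm_one]
    nlinarith [norm_nonneg σ]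
  have hd : ∀ k ∉ ({0, -(n : ℤ)} : Set ℤ), 4 ≤ ‖l - ((n : ℂ) + 2 * k) ^ 2‖ := fun k hk => by
      simp only [Set.mem_insert_iff, Set.mem_singleton_iff, not_or] at hk
      exact four_le_diag hn hn2 hl hk.1 hk.2
  have hn0 : -(n : ℤ) ≠ 0 := by omega
  obtain ⟨c, ⟨M, hM⟩, hE, hc⟩ := exists_bounded_solution
    (b := fun k => if k = 0 then 1 else σ) (a := a) (by linarith) hd
    (fun k => by split_ifs <;> simp [hσ1])
  have c0 : c 0 = 1 := by simpa using hE 0 (by simp)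
  have c1 : c (-n) = σ := by simpa [hn0, show n ≠ 0 by omega] using hE (-n) (by simp)
  have hc' : ∀ k : ℤ, k ≠ 0 → k ≠ -n → HillEq n a l c k := fun k h0 h1 => hc k (by simp [h0, h1])
  refine ⟨c, ?_, c0, ?_, hc'⟩
  · refine norm_le_of_recursion (by linarith) hd hc hM zero_le_one ?_
    rintro k (rfl | rfl)
    · simp [c0]
    · simp [c1, hσ1]
  · intro k
    -- The reflected sequence and `σ * c` agree at `0` and `-n` because `σ ^ 2 = 1`; uniqueness
    -- makes them equal.
    have := eq_of_hillEq hn hn2 ha hl (c := fun j => c (-n - j)) (e := fun j => σ * c j)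
      (fun k => hM _) (M' := M) (fun k => by rw [norm_mul, hσ1, one_mul]; exact hM k)
      (fun k h0 h1 => (hc' _ (by omega) (by omega)).reflect)
      (fun k h0 h1 => (hc' _ h0 h1).const_mul σ) (by simp [c0, c1])
      (by simp [c0, c1, ← sq, hσ])
    exact congrFun this k

/-! ### Summability and the Wronskian identity -/

theorem summable_one_div_one_add_sq (n : ℕ) :
    Summable fun k : ℤ => 1 / (1 + ((n : ℝ) + 2 * k) ^ 2) := by
  -- The offset `1 / 4` keeps all denominators nonzero, as `4k + 2n + 1` is odd.
  have h := (Real.summable_one_div_int_add_rpow ((n : ℝ) / 2 + 1 / 4) 2).2 (by norm_num)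
  refine Summable.of_nonneg_of_le (fun k => by positivity) (fun k => ?_) h
  have h0 : (k : ℝ) + (n / 2 + 1 / 4) ≠ 0 := by
    intro h
    have h2 : (4 * k + 2 * n + 1 : ℝ) = 0 := by linarith
    have h3 : 4 * k + 2 * n + 1 = 0 := by exact_mod_cast h2
    omega
  have h1 : |(k : ℝ) + (n / 2 + 1 / 4)| ^ (2 : ℝ) = (k + (n / 2 + 1 / 4)) ^ 2 := by
    rw [Real.rpow_two, sq_abs]
  rw [h1]
  apply one_div_le_one_div_of_le (by positivity)
  nlinarith [sq_nonneg ((n : ℝ) + 2 * k), sq_nonneg ((n : ℝ) + 2 * k - 1)]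

/-- Solved for `(n + 2k) ^ 2 * c k`, the recursion shows that `c` decays quadratically. -/
theorem summable_of_hillEq {n : ℕ} {a l : ℂ} {c : ℤ → ℂ} {M : ℝ} (hM : ∀ k, ‖c k‖ ≤ M)
    (hc : ∀ k : ℤ, k ≠ 0 → k ≠ -n → HillEq n a l c k) : Summable fun k => ‖c k‖ := by
  have hM0 : 0 ≤ M := (norm_nonneg _).trans (hM 0)
  have key : ∀ k : ℤ, (1 + ((n : ℝ) + 2 * k) ^ 2) * ‖c k‖ ≤
      (1 + ‖l‖ + 2 * ‖a‖ + (n : ℝ) ^ 2) * M := by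
    intro k
    by_cases h : k = 0 ∨ k = -n
    · have : ((n : ℝ) + 2 * k) ^ 2 = (n : ℝ) ^ 2 := by
        rcases h with rfl | rfl <;> push_cast <;> ring
      rw [this]
      have := hM k
      gcongr
      linarith [norm_nonneg l, norm_nonneg a]
    · push Not at h
      have h1 := hc k h.1 h.2
      have h2 : ((n : ℂ) + 2 * k) ^ 2 * c k = l * c k - a * (c (k - 1) + c (k + 1)) := by
        simp only [HillEq] at h1
        linear_combination -h1
      have h3 : ‖((n : ℂ) + 2 * k) ^ 2‖ = ((n : ℝ) + 2 * k) ^ 2 := by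
        rw [norm_pow, show ((n : ℂ) + 2 * k) = (((n : ℝ) + 2 * k : ℝ) : ℂ) by push_cast; ring,
          Complex.norm_real, Real.norm_eq_abs, sq_abs]
      have h4 : ((n : ℝ) + 2 * k) ^ 2 * ‖c k‖ ≤ ‖l‖ * M + ‖a‖ * (M + M) := by
        rw [← h3, ← norm_mul, h2]
        refine (norm_sub_le _ _).trans ?_
        rw [norm_mul, norm_mul]
        gcongr
        · exact hM k
        · exact (norm_add_le _ _).trans (add_le_add (hM _) (hM _))
      nlinarith [hM k, sq_nonneg (n : ℝ)]
  refine Summable.of_nonneg_of_le (fun k => norm_nonneg _) (fun k => ?_)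
    ((summable_one_div_one_add_sq n).mul_left ((1 + ‖l‖ + 2 * ‖a‖ + (n : ℝ) ^ 2) * M))
  rw [mul_one_div, le_div_iff₀ (by positivity), mul_comm]
  exact key k

theorem IsReduced.summable {n : ℕ} {a l σ : ℂ} {c : ℤ → ℂ} (h : IsReduced n a l σ c) :
    Summable fun k => ‖c k‖ :=
  summable_of_hillEq h.le_one h.eq

theorem hasSum_ite_mem_finset {α : Type*} [AddCommMonoid α] [TopologicalSpace α] (N : Finset ℤ)
    (x : α) : HasSum (fun k => if k ∈ N then x else 0) (N.card • x) := by
  have h : HasSum (fun k => if k ∈ N then x else 0) (∑ k ∈ N, if k ∈ N then x else 0) :=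
    hasSum_sum_of_ne_finset_zero fun k hk => if_neg hk
  rwa [Finset.sum_congr rfl (g := fun _ => x) (fun k hk => if_pos hk), Finset.sum_const] at h

/-- The discrete Laplacian is symmetric with respect to the bilinear pairing. -/
theorem hasSum_wronskian {c e : ℤ → ℂ} (hc : Summable fun k => ‖c k‖) (he : ∀ k, ‖e k‖ ≤ 1) :
    HasSum (fun k => e k * (c (k - 1) + c (k + 1)) - c k * (e (k - 1) + e (k + 1))) 0 := by
  have hs : ∀ j : ℤ, Summable fun k => c k * e (k + j) := fun j =>
    Summable.of_norm_bounded hc fun k => by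
      rw [norm_mul]; exact mul_le_of_le_one_right (norm_nonneg _) (he _)
  have h1 := (hs 1).hasSum
  have h2 := (hs (-1)).hasSum
  have h3 := (Equiv.addRight (1 : ℤ)).hasSum_iff.2 h2
  have h4 := (Equiv.addRight (-1 : ℤ)).hasSum_iff.2 h1
  have := (h3.add h4).sub (h1.add h2)
  rw [add_comm (∑' k, c k * e (k + 1)), sub_self] at this
  convert! this using 2 with k
  simp only [Function.comp, Equiv.coe_addRight, ← sub_eq_add_neg, sub_add_cancel,
    add_sub_cancel_right]
  ring

/-- The eigenvalue that belongs to a normalized solution is `n^2 + shift`. -/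
def shift (a : ℂ) (c : ℤ → ℂ) : ℂ := a * (c (-1) + c 1)

/-- Cross-multiply the two recursions, subtract and sum over `k`: the neighbour terms cancel by
`hasSum_wronskian`. The indices `0` and `-n` contribute one difference of shifts each, all others
`(l - l') * c k * e k`. A Lipschitz bound thus needs only a bound on the sum. -/
theorem IsReduced.shift_sub {n : ℕ} (hn : 1 ≤ n) {a l l' σ : ℂ} {c e : ℤ → ℂ} (hσ : σ ^ 2 = 1)
    (hc : IsReduced n a l σ c) (he : IsReduced n a l' σ e) :
    2 * (shift a c - shift a e) =
      -(l - l') * ∑' k : ℤ, if k ∈ ({0, -(n : ℤ)} : Finset ℤ) then 0 else c k * e k := by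
  have hn0 : (0 : ℤ) ≠ -n := by omega
  have h1 := (hasSum_wronskian hc.summable he.le_one).mul_left a
  have hs : Summable fun k : ℤ => if k ∈ ({0, -(n : ℤ)} : Finset ℤ) then 0 else c k * e k :=
    Summable.of_norm_bounded hc.summable fun k => by
      split_ifs
      · simp
      · rw [norm_mul]; exact mul_le_of_le_one_right (norm_nonneg _) (he.le_one _)
  have h2 := hs.hasSum.mul_left (l - l')
  have h3 := hasSum_ite_mem_finset {0, -(n : ℤ)} (shift a c - shift a e)
  rw [Finset.card_pair hn0] at h3
  have h4 := (h2.add h3).unique (by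
    convert! h1 using 2 with k
    by_cases hk : k ∈ ({0, -(n : ℤ)} : Finset ℤ)
    · simp only [if_pos hk, mul_zero, zero_add]
      simp only [Finset.mem_insert, Finset.mem_singleton] at hk
      rcases hk with rfl | rfl
      · simp only [hc.zero, he.zero, shift, zero_sub, zero_add]; ring
      · have e1 := he.symm 0
        have e2 := he.symm 1
        have e3 := he.symm (-1)
        have c1 := hc.symm 0
        have c2 := hc.symm 1
        have c3 := hc.symm (-1)
        simp only [sub_zero, sub_neg_eq_add] at e1 e2 e3 c1 c2 c3
        rw [e1, e2, e3, c1, c2, c3, hc.zero, he.zero]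
        simp only [shift]
        linear_combination (-(a * (c (-1) + c 1)) + a * (e (-1) + e 1)) * hσ
    · simp only [if_neg hk, add_zero]
      simp only [Finset.mem_insert, Finset.mem_singleton, not_or] at hk
      have e1 := hc.eq k hk.1 hk.2
      have e2 := he.eq k hk.1 hk.2
      simp only [HillEq] at e1 e2
      linear_combination e k * e1 - c k * e2)
  rw [mul_zero, two_nsmul] at h4
  linear_combination h4

/-! ### Quantitative bounds and the contraction constant -/

theorem IsReduced.mul_norm_le {n : ℕ} {a l σ : ℂ} {c : ℤ → ℂ} (ha : ‖a‖ ≤ 2)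
    (hc : IsReduced n a l σ c) {k : ℤ} (h0 : k ≠ 0) (h1 : k ≠ -n) {w : ℝ}
    (hw : w ≤ ‖l - ((n : ℂ) + 2 * k) ^ 2‖) :
    w * ‖c k‖ ≤ 2 * (‖c (k - 1)‖ + ‖c (k + 1)‖) := by
  calc w * ‖c k‖ ≤ ‖l - ((n : ℂ) + 2 * k) ^ 2‖ * ‖c k‖ := by gcongr
    _ = ‖a‖ * ‖c (k - 1) + c (k + 1)‖ := by rw [← norm_mul, hc.eq k h0 h1, norm_mul]
    _ ≤ _ := by gcongr; exact norm_add_le _ _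

theorem IsReduced.norm_le {n : ℕ} {a l σ : ℂ} {c : ℤ → ℂ} (ha : ‖a‖ ≤ 2)
    (hc : IsReduced n a l σ c) {k : ℤ} (h0 : k ≠ 0) (h1 : k ≠ -n) {w s : ℝ}
    (hw : w ≤ ‖l - ((n : ℂ) + 2 * k) ^ 2‖) (hs : 4 ≤ w * s) (hw0 : 0 < w) :
    ‖c k‖ ≤ s := by
  have := hc.mul_norm_le ha h0 h1 hw
  have := hc.le_one (k - 1)
  have := hc.le_one (k + 1)
  nlinarith

/-- Summing `w * ‖c k‖ ≤ 2 * (‖c (k - 1)‖ + ‖c (k + 1)‖)` over `k ∉ N` bounds `w` times the tail by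
`4 * ∑ ‖c k‖`, and the indices in `N` add at most `N.card` to that sum. -/
theorem IsReduced.tsum_tail_le {n : ℕ} {a l σ : ℂ} {c : ℤ → ℂ} (ha : ‖a‖ ≤ 2)
    (hc : IsReduced n a l σ c) {N : Finset ℤ} (h0 : 0 ∈ N) (h1 : -(n : ℤ) ∈ N) {w : ℝ}
    (hw : ∀ k ∉ N, w ≤ ‖l - ((n : ℂ) + 2 * k) ^ 2‖) :
    (w - 4) * ∑' k : ℤ, (if k ∈ N then 0 else ‖c k‖) ≤ 4 * N.card := by
  set f : ℤ → ℝ := fun k => if k ∈ N then 0 else ‖c k‖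
  have hf : Summable f := Summable.of_nonneg_of_le
    (fun k => by dsimp only [f]; split_ifs <;> positivity)
    (fun k => by dsimp only [f]; split_ifs <;> simp) hc.summable
  have hi := hasSum_ite_mem_finset N (1 : ℝ)
  rw [nsmul_eq_mul, mul_one] at hi
  have hall : ∑' k, ‖c k‖ ≤ ∑' k, f k + N.card := by
    refine hasSum_le (fun k => ?_) hc.summable.hasSum (hf.hasSum.add hi)
    dsimp only [f]
    split_ifs
    · simpa using hc.le_one k
    · simp
  have hp := (Equiv.addRight (1 : ℤ)).hasSum_iff.2 hc.summable.hasSum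
  have hm := (Equiv.addRight (-1 : ℤ)).hasSum_iff.2 hc.summable.hasSum
  have := hasSum_le (fun k => ?_) (hf.hasSum.mul_left w) ((hm.add hp).mul_left 2)
  · linarith
  · dsimp only [f, Function.comp, Equiv.coe_addRight, Pi.add_apply]
    split_ifs with hk
    · rw [mul_zero]; positivity
    · exact hc.mul_norm_le ha (by rintro rfl; exact hk h0) (by rintro rfl; exact hk h1) (hw k hk)

/-- Near indices are bounded term by term, the far ones by pairing a sup bound on `e` with an `ℓ¹`
bound on `c`. -/
theorem tsum_mul_le_of_tail {c e : ℤ → ℂ} (hc : Summable fun k => ‖c k‖) {E N : Finset ℤ}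
    {x s Y S : ℝ} (hx : ∀ k ∈ N \ E, ‖c k‖ ≤ x ∧ ‖e k‖ ≤ x)
    (hs : ∀ k ∉ N, ‖e k‖ ≤ s) (hs0 : 0 ≤ s) (hx0 : 0 ≤ x)
    (hY : ∑' k : ℤ, (if k ∈ N then 0 else ‖c k‖) ≤ Y)
    (hS : (N \ E).card * x ^ 2 + s * Y ≤ S) :
    ‖∑' k : ℤ, if k ∈ E then 0 else c k * e k‖ ≤ S := by
  set f : ℤ → ℝ := fun k => if k ∈ N then 0 else ‖c k‖
  have hf : Summable f := Summable.of_nonneg_of_le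
    (fun k => by dsimp only [f]; split_ifs <;> positivity)
    (fun k => by dsimp only [f]; split_ifs <;> simp) hc
  have hi := hasSum_ite_mem_finset (N \ E) (x ^ 2)
  rw [nsmul_eq_mul] at hi
  have := tsum_of_norm_bounded (hi.add (hf.hasSum.mul_left s))
    (f := fun k => if k ∈ E then 0 else c k * e k) (fun k => ?_)
  · refine this.trans (le_trans ?_ hS)
    gcongr
  · have hfk : 0 ≤ f k := by dsimp only [f]; split_ifs <;> positivity
    by_cases hE : k ∈ E
    · rw [if_pos hE, norm_zero]
      have : 0 ≤ (if k ∈ N \ E then x ^ 2 else 0) := by split_ifs <;> positivity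
      positivity
    · rw [if_neg hE, norm_mul]
      by_cases hN : k ∈ N
      · have hk : k ∈ N \ E := Finset.mem_sdiff.2 ⟨hN, hE⟩
        rw [if_pos hk]
        have h1 := hx k hk
        have h2 : ‖c k‖ * ‖e k‖ ≤ x * x := mul_le_mul h1.1 h1.2 (norm_nonneg _) hx0
        nlinarith [mul_nonneg hs0 hfk]
      · have hk : k ∉ N \ E := fun h => hN (Finset.mem_sdiff.1 h).1
        rw [if_neg hk, zero_add]
        simp only [f, if_neg hN]
        rw [mul_comm]
        gcongr
        exact hs k hN

theorem norm_eq_one_of_sq_eq_one {σ : ℂ} (hσ : σ ^ 2 = 1) : ‖σ‖ = 1 := by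
  have : ‖σ‖ ^ 2 = 1 := by rw [← norm_pow, hσ, norm_one]
  nlinarith [norm_nonneg σ]

theorem IsReduced.norm_reflect {n : ℕ} {a l σ : ℂ} {c : ℤ → ℂ} (hσ : σ ^ 2 = 1)
    (hc : IsReduced n a l σ c) (k : ℤ) : ‖c (-n - k)‖ = ‖c k‖ := by
  rw [hc.symm, norm_mul, norm_eq_one_of_sq_eq_one hσ, one_mul]

theorem six_le_gap_one {k : ℤ} (hk : k ∉ ({-2, -1, 0, 1} : Finset ℤ)) :
    6 ≤ |k * (k + (1 : ℕ))| := by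
  simp only [Finset.mem_insert, Finset.mem_singleton, not_or] at hk
  push_cast
  rw [le_abs]
  left
  rcases lt_or_gt_of_ne hk.2.2.1 with h | h
  · have : k ≤ -3 := by omega
    nlinarith
  · have : 2 ≤ k := by omega
    nlinarith

theorem four_le_gap_three {k : ℤ} (hk : k ∉ ({-3, -2, -1, 0} : Finset ℤ)) :
    4 ≤ |k * (k + (3 : ℕ))| := by
  simp only [Finset.mem_insert, Finset.mem_singleton, not_or] at hk
  push_cast
  rw [le_abs]
  left
  rcases lt_or_gt_of_ne hk.2.2.2 with h | h
  · have : k ≤ -4 := by omega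
    nlinarith
  · nlinarith

/-- A radius that the eigenvalues in the disc of radius `4` satisfy a priori. -/
def radius (n : ℕ) : ℝ := if n = 3 then 8 / 3 else 4

theorem radius_le (n : ℕ) : radius n ≤ 4 := by unfold radius; split_ifs <;> norm_num

theorem IsReduced.bounds_one {a l σ : ℂ} {c : ℤ → ℂ} (ha : ‖a‖ ≤ 2) (hσ : σ ^ 2 = 1)
    (hl : ‖l - ((1 : ℕ) : ℂ) ^ 2‖ ≤ 4) (hc : IsReduced 1 a l σ c) :
    ‖c 1‖ ≤ 2 / 3 ∧ ‖c (-2)‖ ≤ 2 / 3 ∧ (∀ k ∉ ({-2, -1, 0, 1} : Finset ℤ), ‖c k‖ ≤ 1 / 3) ∧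
      ∑' k : ℤ, (if k ∈ ({-2, -1, 0, 1} : Finset ℤ) then 0 else ‖c k‖) ≤ 2 := by
  have hw : ∀ k ∉ ({-2, -1, 0, 1} : Finset ℤ), 12 ≤ ‖l - (((1 : ℕ) : ℂ) + 2 * k) ^ 2‖ :=
    fun k hk => le_norm_diag_of_gap hl (six_le_gap_one hk) (by norm_num)
  have hfar : ∀ k ∉ ({-2, -1, 0, 1} : Finset ℤ), ‖c k‖ ≤ 1 / 3 := fun k hk =>
    hc.norm_le ha (by rintro rfl; simp at hk) (by rintro rfl; simp at hk) (hw k hk) (by norm_num)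
      (by norm_num)
  -- At `k = 1` the neighbours are at most `1` and `1 / 3`, so `4 * ‖c 1‖ ≤ 8 / 3`.
  have h1 : ‖c 1‖ ≤ 2 / 3 := by
    have h := hc.mul_norm_le ha (k := 1) (by norm_num) (by norm_num)
      (four_le_diag le_rfl (by norm_num) hl (by norm_num) (by norm_num))
    have h2 := hfar 2 (by decide)
    norm_num [hc.zero] at h
    linarith
  refine ⟨h1, ?_, hfar, ?_⟩
  · have := hc.norm_reflect hσ 1
    norm_num at this
    rwa [this]
  · have := hc.tsum_tail_le ha (by decide) (by decide) hw
    rw [show ({-2, -1, 0, 1} : Finset ℤ).card = 4 from rfl] at this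
    push_cast at this
    linarith

theorem IsReduced.bounds_three {a l σ : ℂ} {c : ℤ → ℂ} (ha : ‖a‖ ≤ 2)
    (hl : ‖l - ((3 : ℕ) : ℂ) ^ 2‖ ≤ 4) (hc : IsReduced 3 a l σ c) :
    (∀ k ∉ ({-3, -2, -1, 0} : Finset ℤ), ‖c k‖ ≤ 1 / 3) ∧
      ∑' k : ℤ, (if k ∈ ({-3, -2, -1, 0} : Finset ℤ) then 0 else ‖c k‖) ≤ 2 := by
  have hw : ∀ k ∉ ({-3, -2, -1, 0} : Finset ℤ), 12 ≤ ‖l - (((3 : ℕ) : ℂ) + 2 * k) ^ 2‖ :=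
    fun k hk => le_norm_diag_of_gap hl (four_le_gap_three hk) (by norm_num)
  refine ⟨fun k hk => hc.norm_le ha (by rintro rfl; simp at hk) (by rintro rfl; simp at hk)
    (hw k hk) (by norm_num) (by norm_num), ?_⟩
  have := hc.tsum_tail_le ha (by decide) (by decide) hw
  rw [show ({-3, -2, -1, 0} : Finset ℤ).card = 4 from rfl] at this
  push_cast at this
  linarith

/-- The indices `-1` and `-2` are adjacent and exchanged by the reflection, so the inequality at
`-1` closes on itself. On the disc of radius `4` it would give only `‖c (-1)‖ ≤ 1`, hence the radius
`8 / 3`. -/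
theorem IsReduced.near_bounds_three {a l σ : ℂ} {c : ℤ → ℂ} (ha : ‖a‖ ≤ 2) (hσ : σ ^ 2 = 1)
    (hl : ‖l - ((3 : ℕ) : ℂ) ^ 2‖ ≤ 8 / 3) (hc : IsReduced 3 a l σ c) :
    ‖c (-1)‖ ≤ 2 / 3 ∧ ‖c (-2)‖ ≤ 2 / 3 := by
  have h2 : ‖c (-2)‖ = ‖c (-1)‖ := by
    have := hc.norm_reflect hσ (-1)
    norm_num at this
    exact this
  have h := hc.mul_norm_le ha (k := -1) (w := 16 / 3) (by norm_num) (by norm_num)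
    (le_norm_diag_of_gap (g := 2) hl (by norm_num) (by norm_num))
  norm_num [hc.zero, h2] at h
  constructor <;> linarith

theorem IsReduced.bounds_of_four_le {n : ℕ} (hn : 4 ≤ n) {a l σ : ℂ} {c : ℤ → ℂ} (ha : ‖a‖ ≤ 2)
    (hl : ‖l - (n : ℂ) ^ 2‖ ≤ 4) (hc : IsReduced n a l σ c) :
    (∀ k ∉ ({0, -(n : ℤ)} : Finset ℤ), ‖c k‖ ≤ 1 / 2) ∧
      ∑' k : ℤ, (if k ∈ ({0, -(n : ℤ)} : Finset ℤ) then 0 else ‖c k‖) ≤ 2 := by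
  have hw : ∀ k ∉ ({0, -(n : ℤ)} : Finset ℤ), 8 ≤ ‖l - ((n : ℂ) + 2 * k) ^ 2‖ := fun k hk => by
    simp only [Finset.mem_insert, Finset.mem_singleton, not_or] at hk
    exact le_norm_diag_of_gap hl (three_le_gap hn hk.1 hk.2) (by norm_num)
  refine ⟨fun k hk => hc.norm_le ha (by rintro rfl; simp at hk) (by rintro rfl; simp at hk)
    (hw k hk) (by norm_num) (by norm_num), ?_⟩
  have := hc.tsum_tail_le ha (by simp) (by simp) hw
  rw [Finset.card_pair (by omega)] at this
  push_cast at this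
  linarith

theorem IsReduced.norm_shift_le {n : ℕ} (hn : 1 ≤ n) (hn2 : n ≠ 2) {a l σ : ℂ} {c : ℤ → ℂ}
    (ha : ‖a‖ ≤ 2) (hσ : σ ^ 2 = 1) (hl : ‖l - (n : ℂ) ^ 2‖ ≤ 4) (hc : IsReduced n a l σ c) :
    ‖shift a c‖ ≤ radius n := by
  suffices ‖c (-1)‖ + ‖c 1‖ ≤ radius n / 2 by
    calc ‖shift a c‖ ≤ ‖a‖ * (‖c (-1)‖ + ‖c 1‖) := by
          rw [shift, norm_mul]; gcongr; exact norm_add_le _ _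
      _ ≤ 2 * (radius n / 2) := by gcongr
      _ = radius n := by ring
  have hm := hc.le_one (-1)
  obtain rfl | rfl | hn4 : n = 1 ∨ n = 3 ∨ 4 ≤ n := by omega
  · have := (hc.bounds_one ha hσ hl).1
    norm_num [radius]
    linarith
  · have := (hc.bounds_three ha hl).1 1 (by decide)
    norm_num [radius]
    linarith
  · obtain ⟨h, -⟩ := hc.bounds_of_four_le hn4 ha hl
    have h1 := h 1 (by simp; omega)
    have h2 := h (-1) (by simp; omega)
    rw [radius, if_neg (by omega)]
    linarith

/-- `14 / 9 = 2 * (2 / 3) ^ 2 + (1 / 3) * 2` for `n = 1, 3`; for `n ≥ 4` the tail alone gives `(1 /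
2) * 2 = 1`. Any bound below `2` yields a contraction. -/
theorem IsReduced.norm_tsum_le {n : ℕ} (hn : 1 ≤ n) (hn2 : n ≠ 2) {a l l' σ : ℂ} {c e : ℤ → ℂ}
    (ha : ‖a‖ ≤ 2) (hσ : σ ^ 2 = 1) (hl : ‖l - (n : ℂ) ^ 2‖ ≤ radius n)
    (hl' : ‖l' - (n : ℂ) ^ 2‖ ≤ radius n) (hc : IsReduced n a l σ c) (he : IsReduced n a l' σ e) :
    ‖∑' k : ℤ, if k ∈ ({0, -(n : ℤ)} : Finset ℤ) then 0 else c k * e k‖ ≤ 14 / 9 := by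
  have hl4 := hl.trans (radius_le n)
  have hl4' := hl'.trans (radius_le n)
  obtain rfl | rfl | hn4 : n = 1 ∨ n = 3 ∨ 4 ≤ n := by omega
  · obtain ⟨h1, h2, -, h3⟩ := hc.bounds_one ha hσ hl4
    obtain ⟨e1, e2, e3, -⟩ := he.bounds_one ha hσ hl4'
    refine tsum_mul_le_of_tail (x := 2 / 3) hc.summable ?_ e3 (by norm_num) (by norm_num) h3 ?_
    · rw [show ({-2, -1, 0, 1} : Finset ℤ) \ {0, -((1 : ℕ) : ℤ)} = {-2, 1} from rfl]
      simp [h1, h2, e1, e2]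
    · rw [show (({-2, -1, 0, 1} : Finset ℤ) \ {0, -((1 : ℕ) : ℤ)}).card = 2 from rfl]
      norm_num
  · obtain ⟨-, h3⟩ := hc.bounds_three ha hl4
    obtain ⟨e3, -⟩ := he.bounds_three ha hl4'
    rw [radius, if_pos rfl] at hl hl'
    obtain ⟨h1, h2⟩ := hc.near_bounds_three ha hσ hl
    obtain ⟨e1, e2⟩ := he.near_bounds_three ha hσ hl'
    refine tsum_mul_le_of_tail (x := 2 / 3) hc.summable ?_ e3 (by norm_num) (by norm_num) h3 ?_
    · rw [show ({-3, -2, -1, 0} : Finset ℤ) \ {0, -((3 : ℕ) : ℤ)} = {-2, -1} from rfl]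
      simp [h1, h2, e1, e2]
    · rw [show (({-3, -2, -1, 0} : Finset ℤ) \ {0, -((3 : ℕ) : ℤ)}).card = 2 from rfl]
      norm_num
  · obtain ⟨-, h3⟩ := hc.bounds_of_four_le hn4 ha hl4
    obtain ⟨e3, -⟩ := he.bounds_of_four_le hn4 ha hl4'
    refine tsum_mul_le_of_tail (x := 0) hc.summable ?_ e3 (by norm_num) le_rfl h3 ?_
    · simp
    · norm_num

theorem IsReduced.shift_lipschitz {n : ℕ} (hn : 1 ≤ n) (hn2 : n ≠ 2) {a l l' σ : ℂ}
    {c e : ℤ → ℂ} (ha : ‖a‖ ≤ 2) (hσ : σ ^ 2 = 1) (hl : ‖l - (n : ℂ) ^ 2‖ ≤ radius n)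
    (hl' : ‖l' - (n : ℂ) ^ 2‖ ≤ radius n) (hc : IsReduced n a l σ c)
    (he : IsReduced n a l' σ e) : ‖shift a c - shift a e‖ ≤ 7 / 9 * ‖l - l'‖ := by
  have h := congrArg norm (hc.shift_sub hn hσ he)
  rw [norm_mul, norm_mul, norm_neg, Complex.norm_ofNat] at h
  nlinarith [hc.norm_tsum_le hn hn2 ha hσ hl hl' he, norm_nonneg (l - l')]

/-! ### Eigenvalues as fixed points; parity and conjugation -/

/-- A normalized solution that satisfies the recursion at all indices. -/
structure IsHillSolution (n : ℕ) (a l σ : ℂ) (c : ℤ → ℂ) : Prop extends IsReduced n a l σ c where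
  all : ∀ k, HillEq n a l c k

/-- The hypothesis on `l` is the missing equation at `0`; the one at `-n` is its reflection. -/
theorem IsReduced.isHillSolution {n : ℕ} {a l σ : ℂ} {c : ℤ → ℂ} (hσ : σ ^ 2 = 1)
    (hc : IsReduced n a l σ c) (h : l = (n : ℂ) ^ 2 + shift a c) : IsHillSolution n a l σ c := by
  refine ⟨hc, fun k => ?_⟩
  have h0 : HillEq n a l c 0 := by
    simp only [HillEq, hc.zero, zero_sub, zero_add]
    rw [shift] at h
    push_cast
    linear_combination h
  by_cases hk : k = 0
  · rwa [hk]
  by_cases hk' : k = -n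
  · subst hk'
    have h1 : HillEq n a l c (-n - -n) := by rwa [sub_self]
    have h2 := h1.reflect.const_mul σ
    convert h2 using 2 with j
    rw [hc.symm, ← mul_assoc, ← sq, hσ, one_mul]
  · exact hc.eq k hk hk'

theorem IsHillSolution.eq_add_shift {n : ℕ} {a l σ : ℂ} {c : ℤ → ℂ}
    (hc : IsHillSolution n a l σ c) : l = (n : ℂ) ^ 2 + shift a c := by
  have := hc.all 0
  simp only [HillEq, hc.zero, zero_sub, zero_add] at this
  push_cast at this
  rw [shift]
  linear_combination this

/-- In each parity class there is exactly one eigenvalue in the disc. -/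
theorem existsUnique_hillSolution {n : ℕ} (hn : 1 ≤ n) (hn2 : n ≠ 2) {a σ : ℂ} (ha : ‖a‖ < 2)
    (hσ : σ ^ 2 = 1) :
    ∃! l, ‖l - (n : ℂ) ^ 2‖ ≤ 4 ∧ ∃ c, IsHillSolution n a l σ c := by
  have hex : ∀ l : ℂ, ∃ c, ‖l - (n : ℂ) ^ 2‖ ≤ 4 → IsReduced n a l σ c := fun l => by
    by_cases h : ‖l - (n : ℂ) ^ 2‖ ≤ 4
    · obtain ⟨c, hc⟩ := exists_isReduced hn hn2 ha h hσ
      exact ⟨c, fun _ => hc⟩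
    · exact ⟨0, fun h' => absurd h' h⟩
  choose c hc using hex
  let Φ : ℂ → ℂ := fun l => (n : ℂ) ^ 2 + shift a (c l)
  let D : Set ℂ := Metric.closedBall ((n : ℂ) ^ 2) (radius n)
  have hD : ∀ {l}, l ∈ D → ‖l - (n : ℂ) ^ 2‖ ≤ radius n := fun h => by
    rwa [Metric.mem_closedBall, dist_eq_norm] at h
  have hmaps : Set.MapsTo Φ D D := fun l hl => by
    rw [Metric.mem_closedBall, dist_eq_norm, add_sub_cancel_left]
    have h4 := (hD hl).trans (radius_le n)
    exact (hc l h4).norm_shift_le hn hn2 ha.le hσ h4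
  have hcontr : ContractingWith (7 / 9) (hmaps.restrict Φ D D) := by
    refine ⟨by rw [← NNReal.coe_lt_coe]; norm_num, LipschitzWith.of_dist_le_mul ?_⟩
    rintro ⟨l, hl⟩ ⟨l', hl'⟩
    rw [Subtype.dist_eq, Subtype.dist_eq, dist_eq_norm, dist_eq_norm]
    simp only [Set.MapsTo.val_restrict_apply, Φ, add_sub_add_left_eq_sub]
    have := (hc l ((hD hl).trans (radius_le n))).shift_lipschitz hn hn2 ha.le hσ (hD hl) (hD hl')
      (hc l' ((hD hl').trans (radius_le n)))
    simpa using this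
  have hr : 0 ≤ radius n := by unfold radius; split_ifs <;> norm_num
  obtain ⟨l, hl, hfix, -⟩ := hcontr.exists_fixedPoint' (Metric.isClosed_closedBall.isComplete) hmaps
    (Metric.mem_closedBall_self hr) (edist_ne_top _ _)
  have hl4 := (hD hl).trans (radius_le n)
  refine ⟨l, ⟨hl4, c l, (hc l hl4).isHillSolution hσ hfix.symm⟩, ?_⟩
  rintro l' ⟨hl', e, he⟩
  have h1 := he.eq_add_shift
  have h2 : l = (n : ℂ) ^ 2 + shift a (c l) := hfix.symm
  -- The bound on the shift places every eigenvalue of the larger disc in the disc where the map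
  -- contracts.
  have h3 : ‖l' - (n : ℂ) ^ 2‖ ≤ radius n := by
    rw [sub_eq_of_eq_add' h1]
    exact he.norm_shift_le hn hn2 ha.le hσ hl'
  have h4 := he.shift_lipschitz hn hn2 ha.le hσ h3 (hD hl) (hc l hl4)
  have h5 : l' - l = shift a e - shift a (c l) := by
    linear_combination h1 - h2
  rw [← h5] at h4
  have h6 : ‖l' - l‖ = 0 := by linarith [norm_nonneg (l' - l)]
  exact sub_eq_zero.1 (norm_eq_zero.1 h6)

/-- A bounded solution of the full recursion has, after normalization, a parity. -/
theorem exists_hillSolution_of_bounded {n : ℕ} (hn : 1 ≤ n) (hn2 : n ≠ 2) {a l : ℂ}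
    (ha : ‖a‖ < 2) (hl : ‖l - (n : ℂ) ^ 2‖ ≤ 4) {c : ℤ → ℂ} {M : ℝ} (hM : ∀ k, ‖c k‖ ≤ M)
    (hc : ∀ k, HillEq n a l c k) (hne : c ≠ 0) :
    (∃ e, IsHillSolution n a l 1 e) ∨ ∃ e, IsHillSolution n a l (-1) e := by
  -- The part of `c` of parity `σ` is a multiple of the normalized solution. If both parts vanish at
  -- `0`, then `c` vanishes at `0` and `-n`, hence everywhere.
  have key : ∀ σ : ℂ, σ ^ 2 = 1 → c 0 + σ * c (-n) ≠ 0 → ∃ e, IsHillSolution n a l σ e := by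
    intro σ hσ h0
    have hσ1 := norm_eq_one_of_sq_eq_one hσ
    obtain ⟨e, he⟩ := exists_isReduced hn hn2 ha hl hσ
    have hu : ∀ k, HillEq n a l (fun j => c j + σ * c (-n - j)) k := fun k =>
      (hc k).add ((hc _).reflect.const_mul σ)
    have heq : (fun j => c j + σ * c (-n - j)) = fun j => (c 0 + σ * c (-n)) * e j := by
      refine eq_of_hillEq hn hn2 ha hl (M := M + M) (M' := ‖c 0 + σ * c (-n)‖) (fun k => ?_)
        (fun k => ?_) (fun k _ _ => hu k) (fun k h0 h1 => (he.eq k h0 h1).const_mul _) ?_ ?_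
      · refine (norm_add_le _ _).trans (add_le_add (hM _) ?_)
        rw [norm_mul, hσ1, one_mul]
        exact hM _
      · rw [norm_mul]
        exact mul_le_of_le_one_right (norm_nonneg _) (he.le_one k)
      · simp [he.zero]
      · have := he.symm 0
        rw [sub_zero, he.zero, mul_one] at this
        simp only [sub_self, this]
        linear_combination -(c (-n)) * hσ
    refine ⟨e, he, fun k => ?_⟩
    have h := (hu k).const_mul (c 0 + σ * c (-n))⁻¹
    convert! h using 2 with j
    have := congrFun heq j
    rw [this, inv_mul_cancel_left₀ h0]
  by_contra! hcon
  have h1 : c 0 + 1 * c (-n) = 0 := by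
    by_contra h
    obtain ⟨e, he⟩ := key 1 (by norm_num) h
    exact hcon.1 e he
  have h2 : c 0 + -1 * c (-n) = 0 := by
    by_contra h
    obtain ⟨e, he⟩ := key (-1) (by norm_num) h
    exact hcon.2 e he
  have h3 : c 0 = 0 := by linear_combination (h1 + h2) / 2
  have h4 : c (-n) = 0 := by linear_combination (h1 - h2) / 2
  exact hne (eq_of_hillEq hn hn2 ha hl hM (M' := 0) (e := 0) (by simp) (fun k _ _ => hc k)
    (fun k _ _ => by simp [HillEq]) h3 h4)

/-- The two parity classes have no eigenvalue in common. -/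
theorem not_hillSolution_both {n : ℕ} {a l : ℂ} (ha : a ≠ 0) {c e : ℤ → ℂ}
    (hc : IsHillSolution n a l 1 c) (he : IsHillSolution n a l (-1) e) : False := by
  -- The discrete Wronskian is constant in `k`; as both solutions decay, it is zero.
  have hstep : ∀ k, c (k + 1) * e (k + 1 + 1) - c (k + 1 + 1) * e (k + 1) =
      c k * e (k + 1) - c (k + 1) * e k := by
    intro k
    have h1 := hc.all (k + 1)
    have h2 := he.all (k + 1)
    simp only [HillEq, add_sub_cancel_right] at h1 h2
    apply mul_left_cancel₀ ha
    linear_combination e (k + 1) * h1 - c (k + 1) * h2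
  have hconst : ∀ k : ℕ, c k * e (k + 1) - c (k + 1) * e k = c 0 * e 1 - c 1 * e 0 := by
    intro k
    induction k with
    | zero => simp
    | succ k ih =>
      rw [← ih]
      push_cast
      exact hstep k
  have hct : Filter.Tendsto (fun k : ℕ => c k) Filter.atTop (nhds 0) :=
    (hc.summable.of_norm.comp_injective Nat.cast_injective).tendsto_atTop_zero
  have hct' : Filter.Tendsto (fun k : ℕ => c (k + 1)) Filter.atTop (nhds 0) := by
    have := (Filter.tendsto_add_atTop_iff_nat 1).2 hct
    simpa using this
  have het : Filter.Tendsto (fun k : ℕ => e k) Filter.atTop (nhds 0) :=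
    (he.summable.of_norm.comp_injective Nat.cast_injective).tendsto_atTop_zero
  have het' : Filter.Tendsto (fun k : ℕ => e (k + 1)) Filter.atTop (nhds 0) := by
    have := (Filter.tendsto_add_atTop_iff_nat 1).2 het
    simpa using this
  have hW : c 0 * e 1 - c 1 * e 0 = 0 := by
    have h := (hct.mul het').sub (hct'.mul het)
    simp only [hconst, mul_zero, sub_zero] at h
    exact tendsto_nhds_unique tendsto_const_nhds h
  rw [hc.zero, he.zero, one_mul, mul_one, sub_eq_zero] at hW
  -- Now `c` and `e` agree at `0` and `1`, so the recursion run downwards makes them agree at `-n`,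
  -- where they equal `1` and `-1`.
  have hdown : ∀ k : ℕ, c (-k) = e (-k) ∧ c (-k + 1) = e (-k + 1) := by
    intro k
    induction k with
    | zero => simp [hc.zero, he.zero, hW]
    | succ k ih =>
      have h1 := hc.all (-k)
      have h2 := he.all (-k)
      simp only [HillEq] at h1 h2
      rw [ih.1, ih.2] at h1
      have h3 := mul_left_cancel₀ ha (h1.symm.trans h2)
      push_cast
      rw [neg_add, neg_add_cancel_right]
      exact ⟨add_right_cancel h3, ih.1⟩
  have h1 := hc.symm 0
  have h2 := he.symm 0
  rw [sub_zero, hc.zero] at h1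
  rw [sub_zero, he.zero] at h2
  have := (hdown n).1
  rw [h1, h2] at this
  norm_num at this

/-- Complex conjugation of solutions for an imaginary parameter. -/
theorem IsHillSolution.conj {n : ℕ} {a l σ : ℂ} {c : ℤ → ℂ} (ha : (starRingEnd ℂ) a = -a)
    (hσ : (starRingEnd ℂ) σ = σ) (hc : IsHillSolution n a l σ c) :
    IsHillSolution n a ((starRingEnd ℂ) l) ((-1) ^ n * σ)
      (fun k => (-1) ^ k * (starRingEnd ℂ) (c k)) := by
  have h1 : (-1 : ℂ) ≠ 0 := by norm_num
  -- Conjugation turns `a` into `-a`; the factor `(-1) ^ k` alternates between neighbours and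
  -- restores the sign.
  have hall : ∀ k, HillEq n a ((starRingEnd ℂ) l) (fun k => (-1) ^ k * (starRingEnd ℂ) (c k)) k := by
    intro k
    have h := congrArg (starRingEnd ℂ) (hc.all k)
    simp only [map_mul, map_sub, map_pow, map_add, Complex.conj_natCast, ha, map_ofNat,
      map_intCast] at h
    simp only [HillEq, zpow_sub₀ h1, zpow_add₀ h1, zpow_one, div_neg, div_one]
    linear_combination (-1) ^ k * h
  refine ⟨⟨fun k => ?_, by simp [hc.zero], fun k => ?_, fun k _ _ => hall k⟩, hall⟩
  · rw [norm_mul, norm_zpow, norm_neg, norm_one, one_zpow, one_mul, Complex.norm_conj]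
    exact hc.le_one k
  · have hp : ∀ j : ℤ, (-1 : ℂ) ^ (-j) = (-1) ^ j := fun j => by
      rw [zpow_neg, ← inv_zpow]; norm_num
    have : (-1 : ℂ) ^ (-(n : ℤ) - k) = (-1) ^ n * (-1) ^ k := by
      rw [← hp, neg_sub, sub_neg_eq_add, zpow_add₀ h1, zpow_natCast, mul_comm]
    rw [hc.symm, map_mul, hσ, this]
    ring

/-! ### Passage between the differential operator and the recursion -/

/-- The exponential of frequency `n + 2k`. -/
def mode (n : ℕ) (k : ℤ) (x : ℝ) : ℂ := Complex.exp (((n : ℂ) + 2 * k) * x * Complex.I)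

theorem mode_zero (n : ℕ) (k : ℤ) : mode n k 0 = 1 := by simp [mode]

theorem norm_mode (n : ℕ) (k : ℤ) (x : ℝ) : ‖mode n k x‖ = 1 := by
  rw [mode, show ((n : ℂ) + 2 * k) * x * Complex.I = (((n + 2 * k) * x : ℝ) : ℂ) * Complex.I by
    push_cast; ring, Complex.norm_exp_ofReal_mul_I]

theorem mode_pi (n : ℕ) (k : ℤ) : mode n k Real.pi = (-1) ^ n := by
  rw [mode, show ((n : ℂ) + 2 * k) * Real.pi * Complex.I =
    n * (Real.pi * Complex.I) + k * (2 * Real.pi * Complex.I) by ring, Complex.exp_add,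
    Complex.exp_int_mul_two_pi_mul_I, mul_one, Complex.exp_nat_mul, Complex.exp_pi_mul_I]

theorem exp_boundary (n : ℕ) :
    Complex.exp (Complex.I * ((if Even n then 0 else Real.pi : ℝ) : ℂ)) = (-1) ^ n := by
  split_ifs with h
  · simp [h.neg_one_pow]
  · rw [(Nat.not_even_iff_odd.1 h).neg_one_pow, mul_comm, Complex.exp_pi_mul_I]

theorem mode_neg (n : ℕ) (k : ℤ) (x : ℝ) : mode n k (-x) * mode n k x = 1 := by
  rw [mode, mode, ← Complex.exp_add]
  simp

theorem mode_neg_pi (n : ℕ) (k : ℤ) : mode n k (-Real.pi) = (-1) ^ n := by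
  have h := mode_neg n k Real.pi
  rw [mode_pi] at h
  have h2 : ((-1 : ℂ) ^ n) * (-1) ^ n = 1 := by rw [← mul_pow]; norm_num
  exact mul_right_cancel₀ (pow_ne_zero n (by norm_num : (-1 : ℂ) ≠ 0)) (h.trans h2.symm)

theorem continuous_mode (n : ℕ) (k : ℤ) : Continuous (mode n k) := by
  unfold mode; fun_prop

theorem hasDerivAt_mode (n : ℕ) (k : ℤ) (x : ℝ) :
    HasDerivAt (mode n k) (((n : ℂ) + 2 * k) * Complex.I * mode n k x) x := by
  have h := (((hasDerivAt_id (x : ℂ)).const_mul ((n : ℂ) + 2 * k)).mul_const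
    Complex.I).cexp.comp_ofReal
  simp only [id, mul_one] at h
  convert! h using 1
  rw [mode]; ring

theorem potential_mul_mode (n : ℕ) (k : ℤ) (a : ℂ) (x : ℝ) :
    potential a x * mode n k x = a * (mode n (k - 1) x + mode n (k + 1) x) := by
  rw [potential, mode, mode, mode, ← mul_add, mul_assoc, add_mul, ← Complex.exp_add,
    ← Complex.exp_add]
  push_cast
  ring_nf

theorem potential_neg (a : ℂ) (x : ℝ) : potential a (-x) = potential a x := by
  simp only [potential]
  push_cast
  rw [add_comm]
  ring_nf

theorem continuous_potential (a : ℂ) : Continuous (potential a) := by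
  unfold potential; fun_prop

theorem continuousOn_of_eq_primitive {f g : ℝ → ℂ} {T : ℝ} (hT : 0 ≤ T)
    (hg : IntegrableOn g (Set.Icc 0 T))
    (hf : ∀ x ∈ Set.Icc 0 T, f x = f 0 + ∫ s in (0 : ℝ)..x, g s) :
    ContinuousOn f (Set.Icc 0 T) := by
  have h := intervalIntegral.continuousOn_primitive_interval (f := g) (a := 0) (b := T)
    (μ := volume) (by rwa [Set.uIcc_of_le hT])
  rw [Set.uIcc_of_le hT] at h
  exact (continuousOn_const.add h).congr hf

theorem hasDerivAt_of_eq_primitive {f g : ℝ → ℂ} {T : ℝ} (hg : ContinuousOn g (Set.Icc 0 T))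
    (hf : ∀ x ∈ Set.Icc 0 T, f x = f 0 + ∫ s in (0 : ℝ)..x, g s) {x : ℝ}
    (hx : x ∈ Set.Ioo 0 T) : HasDerivAt f (g x) x := by
  have hmem : Set.Icc 0 T ∈ nhds x := Icc_mem_nhds hx.1 hx.2
  have hint : IntervalIntegrable g volume 0 x := by
    refine ContinuousOn.intervalIntegrable (hg.mono ?_)
    rw [Set.uIcc_of_le hx.1.le]
    exact Set.Icc_subset_Icc_right hx.2.le
  have h := intervalIntegral.integral_hasDerivAt_right hint
    ((hg.mono Set.Ioo_subset_Icc_self).stronglyMeasurableAtFilter isOpen_Ioo x hx)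
    (hg.continuousAt hmem)
  refine (h.const_add (f 0)).congr_of_eventuallyEq ?_
  filter_upwards [hmem] with z hz using hf z hz

theorem memLp_two_of_continuousOn_Icc {f : ℝ → ℂ} {T : ℝ} (hf : ContinuousOn f (Set.Icc 0 T)) :
    MemLp f 2 (volume.restrict (Set.Icc 0 T)) := by
  obtain ⟨C, hC⟩ := isCompact_Icc.exists_bound_of_continuousOn hf
  exact MemLp.of_bound (hf.aestronglyMeasurable measurableSet_Icc) C
    ((ae_restrict_iff' measurableSet_Icc).2 (Filter.Eventually.of_forall hC))

/-- The Fourier coefficients, up to a constant, of `y` on `[0, π]` for the frequencies `n + 2k`. -/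
def hillCoeff (n : ℕ) (y : ℝ → ℂ) (k : ℤ) : ℂ := ∫ x in (0 : ℝ)..Real.pi, y x * mode n k (-x)

theorem norm_hillCoeff_le (n : ℕ) (y : ℝ → ℂ) (k : ℤ) :
    ‖hillCoeff n y k‖ ≤ ∫ x in (0 : ℝ)..Real.pi, ‖y x‖ := by
  refine (intervalIntegral.norm_integral_le_integral_norm Real.pi_pos.le).trans_eq ?_
  simp only [norm_mul, norm_mode, mul_one]

/-- The factor `mode n 0 (-x)` shifts the frequencies to `2k`, those of the Fourier basis on `[0,
π]`. Parseval gives zero `L²` norm, and continuity zero at every point. -/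
theorem eq_zero_of_hillCoeff {n : ℕ} {y : ℝ → ℂ} (hy : ContinuousOn y (Set.Icc 0 Real.pi))
    (h : ∀ k, hillCoeff n y k = 0) : ∀ x ∈ Set.Icc 0 Real.pi, y x = 0 := by
  set f : ℝ → ℂ := fun x => y x * mode n 0 (-x) with hf
  have hfc : ContinuousOn f (Set.Icc 0 Real.pi) :=
    hy.mul ((continuous_mode n 0).comp continuous_neg).continuousOn
  have hL2 : MemLp f 2 (volume.restrict (Set.Ioc 0 Real.pi)) :=
    (memLp_two_of_continuousOn_Icc hfc).mono_measure
      (Measure.restrict_mono Set.Ioc_subset_Icc_self le_rfl)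
  have hsum := hasSum_sq_fourierCoeffOn Real.pi_pos hL2
  have hzero : ∀ k, fourierCoeffOn Real.pi_pos f k = 0 := fun k => by
    rw [fourierCoeffOn_eq_integral]
    have : ∫ x in (0 : ℝ)..Real.pi, fourier (-k) (x : AddCircle (Real.pi - 0)) • f x =
        hillCoeff n y k := by
      refine intervalIntegral.integral_congr fun x _ => ?_
      simp only [f, fourier_coe_apply, smul_eq_mul, mode]
      rw [mul_left_comm, ← Complex.exp_add]
      congr 2
      have : (Real.pi : ℂ) ≠ 0 := by exact_mod_cast Real.pi_ne_zero
      push_cast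
      field_simp
      ring
    rw [this, h k, smul_zero]
  simp only [hzero, norm_zero, ne_eq, OfNat.ofNat_ne_zero, not_false_eq_true, zero_pow] at hsum
  have h0 := hsum.unique hasSum_zero
  have hint : ∫ x in (0 : ℝ)..Real.pi, ‖f x‖ ^ 2 = 0 := by
    rw [sub_zero, smul_eq_mul] at h0
    exact (mul_eq_zero.1 h0).resolve_left (inv_ne_zero Real.pi_ne_zero)
  intro x hx
  by_contra hne
  have hpos := intervalIntegral.integral_pos (f := fun x => ‖f x‖ ^ 2) Real.pi_pos
    (hfc.norm.pow 2) (fun x _ => by positivity) ⟨x, hx, by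
      have : f x ≠ 0 := mul_ne_zero hne (Complex.exp_ne_zero _)
      positivity⟩
  exact hpos.ne' hint

/-- Two integrations by parts in one: integrate the derivative of `(y' + iνy) * exp (-iνx)`. Its
values at `0` and `π` coincide by the boundary conditions. -/
theorem hillEq_hillCoeff {n : ℕ} {a l : ℂ} {y dy : ℝ → ℂ} (hyc : ContinuousOn y (Set.Icc 0 Real.pi))
    (hdc : ContinuousOn dy (Set.Icc 0 Real.pi))
    (hy : ∀ x ∈ Set.Ioo 0 Real.pi, HasDerivAt y (dy x) x)
    (hdy : ∀ x ∈ Set.Ioo 0 Real.pi, HasDerivAt dy ((potential a x - l) * y x) x)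
    (hb : y Real.pi = (-1) ^ n * y 0) (hb' : dy Real.pi = (-1) ^ n * dy 0) (k : ℤ) :
    HillEq n a l (hillCoeff n y) k := by
  have hmc : ∀ k, Continuous fun x : ℝ => mode n k (-x) := fun k =>
    (continuous_mode n k).comp continuous_neg
  have hint : ∀ k, IntervalIntegrable (fun x => y x * mode n k (-x)) volume 0 Real.pi := fun k => by
    refine ContinuousOn.intervalIntegrable ?_
    rw [Set.uIcc_of_le Real.pi_pos.le]
    exact hyc.mul (hmc k).continuousOn
  set ν : ℂ := (n : ℂ) + 2 * k with hν
  have hder : ∀ x ∈ Set.Ioo 0 Real.pi,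
      HasDerivAt (fun x => (dy x + ν * Complex.I * y x) * mode n k (-x))
        (a * (y x * mode n (k - 1) (-x) + y x * mode n (k + 1) (-x)) -
          (l - ν ^ 2) * (y x * mode n k (-x))) x := by
    intro x hx
    have hm : HasDerivAt (fun x => mode n k (-x)) (-(ν * Complex.I * mode n k (-x))) x := by
      convert! (hasDerivAt_mode n k (-x)).scomp x (hasDerivAt_neg x) using 1
      simp [hν]
    have hsum : HasDerivAt (fun x => dy x + ν * Complex.I * y x)
        ((potential a x - l) * y x + ν * Complex.I * dy x) x :=
      (hdy x hx).add ((hy x hx).const_mul _)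
    convert! hsum.mul hm using 1
    have hp := potential_mul_mode n k a (-x)
    rw [potential_neg] at hp
    linear_combination -y x * hp + ν ^ 2 * y x * mode n k (-x) * Complex.I_sq
  have hcont : ContinuousOn (fun x => (dy x + ν * Complex.I * y x) * mode n k (-x))
      (Set.Icc 0 Real.pi) := (hdc.add (continuousOn_const.mul hyc)).mul (hmc k).continuousOn
  have hFTC := intervalIntegral.integral_eq_sub_of_hasDerivAt_of_le Real.pi_pos.le hcont hder
    ((((hint _).add (hint _)).const_mul a).sub ((hint k).const_mul (l - ν ^ 2)))
  rw [intervalIntegral.integral_sub (((hint _).add (hint _)).const_mul a)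
    ((hint k).const_mul (l - ν ^ 2)), intervalIntegral.integral_const_mul,
    intervalIntegral.integral_const_mul, intervalIntegral.integral_add (hint _) (hint _)] at hFTC
  have hpow : ((-1 : ℂ) ^ n) * (-1) ^ n = 1 := by rw [← mul_pow]; norm_num
  simp only [mode_neg_pi, neg_zero, mode_zero, hb, hb'] at hFTC
  simp only [HillEq, hillCoeff, ← hν]
  linear_combination -hFTC - (dy 0 + ν * Complex.I * y 0) * hpow

/-- An eigenfunction yields a bounded nonzero solution of the recursion. -/
theorem IsEigenvalue.exists_solution {n : ℕ} {a l : ℂ}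
    (h : IsEigenvalue (if Even n then 0 else Real.pi) a l) :
    ∃ c : ℤ → ℂ, (∃ M, ∀ k, ‖c k‖ ≤ M) ∧ (∀ k, HillEq n a l c k) ∧ c ≠ 0 := by
  obtain ⟨y, ⟨x₀, hx₀, hne⟩, dy, d2y, hL2, hy, hdy, hb, hb', hae⟩ := h
  rw [exp_boundary] at hb hb'
  have hpi := Real.pi_pos.le
  have hdc := continuousOn_of_eq_primitive hpi (hL2.integrable one_le_two) hdy
  have hyc := continuousOn_of_eq_primitive hpi (hdc.integrableOn_compact isCompact_Icc) hy
  have hgc : ContinuousOn (fun x => (potential a x - l) * y x) (Set.Icc 0 Real.pi) :=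
    ((continuous_potential a).continuousOn.sub continuousOn_const).mul hyc
  -- Replacing `d2y` by a continuous function equal to it almost everywhere makes `dy`
  -- differentiable at every interior point.
  have hdy' : ∀ x ∈ Set.Icc 0 Real.pi,
      dy x = dy 0 + ∫ s in (0 : ℝ)..x, (potential a s - l) * y s := by
    intro x hx
    rw [hdy x hx]
    congr 1
    refine intervalIntegral.integral_congr_ae ?_
    filter_upwards [(ae_restrict_iff' measurableSet_Icc).1 hae] with s hs hs'
    rw [Set.uIoc_of_le hx.1] at hs'
    linear_combination -hs ⟨hs'.1.le, hs'.2.trans hx.2⟩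
  refine ⟨hillCoeff n y, ⟨_, norm_hillCoeff_le n y⟩, ?_, fun h0 => ?_⟩
  · exact hillEq_hillCoeff hyc hdc (fun x hx => hasDerivAt_of_eq_primitive hdc hy hx)
      (fun x hx => hasDerivAt_of_eq_primitive hgc hdy' hx) hb hb'
  · exact hne (eq_zero_of_hillCoeff hyc (fun k => congrFun h0 k) x₀ hx₀)

theorem summable_mul_mode {n : ℕ} {c : ℤ → ℂ} (hc : Summable fun k => ‖c k‖) (x : ℝ) :
    Summable fun k => c k * mode n k x :=
  Summable.of_norm_bounded hc fun k => by rw [norm_mul, norm_mode, mul_one]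

theorem hasDerivAt_tsum_mode {n : ℕ} {c : ℤ → ℂ} (hc : Summable fun k => ‖c k‖)
    (hc' : Summable fun k : ℤ => ‖((n : ℂ) + 2 * k) * Complex.I * c k‖) (x : ℝ) :
    HasDerivAt (fun x => ∑' k, c k * mode n k x)
      (∑' k : ℤ, ((n : ℂ) + 2 * k) * Complex.I * c k * mode n k x) x := by
  refine hasDerivAt_tsum (y₀ := 0) (g := fun k x => c k * mode n k x)
    (g' := fun (k : ℤ) x => ((n : ℂ) + 2 * k) * Complex.I * c k * mode n k x) hc'
    (fun k x => ?_) (fun k x => ?_) (summable_mul_mode (n := n) hc 0) x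
  · convert! (hasDerivAt_mode n k x).const_mul (c k) using 1
    ring
  · rw [norm_mul _ (mode n k x), norm_mode, mul_one]

theorem continuous_tsum_mode {n : ℕ} {c : ℤ → ℂ} (hc : Summable fun k => ‖c k‖) :
    Continuous fun x => ∑' k, c k * mode n k x :=
  continuous_tsum (fun k => continuous_const.mul (continuous_mode n k)) hc fun k x => by
    rw [norm_mul, norm_mode, mul_one]

theorem hillCoeff_mode (n : ℕ) (j k : ℤ) :
    hillCoeff n (mode n j) k = if j = k then (Real.pi : ℂ) else 0 := by
  have hm : ∀ x : ℝ, mode n j x * mode n k (-x) = mode 0 (j - k) x := fun x => by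
    simp only [mode, ← Complex.exp_add]
    push_cast
    ring_nf
  simp only [hillCoeff, hm]
  split_ifs with h
  · simp [h, mode]
  · have h2 : ((0 : ℕ) + 2 * ((j - k : ℤ) : ℂ)) * Complex.I ≠ 0 := by
      refine mul_ne_zero ?_ Complex.I_ne_zero
      rw [Nat.cast_zero, zero_add]
      exact mul_ne_zero two_ne_zero (by exact_mod_cast sub_ne_zero.2 h)
    have hFTC := intervalIntegral.integral_eq_sub_of_hasDerivAt (a := 0) (b := Real.pi)
      (fun x _ => hasDerivAt_mode 0 (j - k) x)
      ((continuous_const.mul (continuous_mode 0 (j - k))).intervalIntegrable _ _)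
    rw [intervalIntegral.integral_const_mul, mode_pi, mode_zero, pow_zero, sub_self] at hFTC
    exact (mul_eq_zero.1 hFTC).resolve_left h2

theorem hillCoeff_tsum_mode {n : ℕ} {c : ℤ → ℂ} (hc : Summable fun k => ‖c k‖) (k : ℤ) :
    hillCoeff n (fun x => ∑' j, c j * mode n j x) k = Real.pi * c k := by
  let F : ℤ → C(ℝ, ℂ) := fun j =>
    ⟨fun x => c j * mode n j x * mode n k (-x), by
      have := continuous_mode n j
      have := (continuous_mode n k).comp continuous_neg
      simp only [Function.comp_def] at this
      fun_prop⟩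
  have h := intervalIntegral.hasSum_intervalIntegral_of_summable_norm (a := 0) (b := Real.pi) (f := F)
    (Summable.of_nonneg_of_le (fun j => norm_nonneg _) (fun j => ?_) hc)
  · have h1 : ∀ j, ∫ x in (0 : ℝ)..Real.pi, F j x = if j = k then (Real.pi : ℂ) * c k else 0 := by
      intro j
      have := hillCoeff_mode n j k
      simp only [hillCoeff] at this
      simp only [F, ContinuousMap.coe_mk, mul_assoc]
      rw [intervalIntegral.integral_const_mul, this]
      split_ifs with hjk
      · rw [hjk, mul_comm]
      · rw [mul_zero]
    simp only [h1] at h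
    rw [(hasSum_ite_eq k ((Real.pi : ℂ) * c k)).unique h, hillCoeff]
    refine intervalIntegral.integral_congr fun x _ => ?_
    simp only [F, ContinuousMap.coe_mk]
    rw [tsum_mul_right]
  · refine (ContinuousMap.norm_le _ (norm_nonneg _)).2 fun x => ?_
    simp [F, norm_mode]

/-- A summable nonzero solution of the recursion yields an eigenfunction. -/
theorem isEigenvalue_of_solution {n : ℕ} {a l : ℂ} {c : ℤ → ℂ} (hc : Summable fun k => ‖c k‖)
    (h : ∀ k, HillEq n a l c k) (hne : c ≠ 0) :
    IsEigenvalue (if Even n then 0 else Real.pi) a l := by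
  have hs : ∀ j : ℤ, Summable fun k => ‖c (k + j)‖ := fun j =>
    (Equiv.addRight j).summable_iff.2 hc
  -- The recursion expresses the coefficients of `y''` through those of `y`, so they are summable
  -- too; those of `y'` follow from `t ≤ 1 + t ^ 2`.
  have h2 : ∀ k : ℤ, ((n : ℂ) + 2 * k) * Complex.I * (((n : ℂ) + 2 * k) * Complex.I * c k) =
      a * (c (k + -1) + c (k + 1)) - l * c k := fun k => by
    have := h k
    simp only [HillEq, sub_eq_add_neg k] at this
    linear_combination this + ((n : ℂ) + 2 * k) ^ 2 * c k * Complex.I_sq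
  have hc2 : Summable fun k : ℤ =>
      ‖((n : ℂ) + 2 * k) * Complex.I * (((n : ℂ) + 2 * k) * Complex.I * c k)‖ := by
    simp only [h2]
    refine Summable.of_nonneg_of_le (fun _ => norm_nonneg _) (fun k => ?_)
      ((((hs (-1)).add (hs 1)).mul_left ‖a‖).add (hc.mul_left ‖l‖))
    refine (norm_sub_le _ _).trans ?_
    rw [norm_mul, norm_mul]
    gcongr
    exact norm_add_le _ _
  have hc1 : Summable fun k : ℤ => ‖((n : ℂ) + 2 * k) * Complex.I * c k‖ := by
    refine Summable.of_nonneg_of_le (fun _ => norm_nonneg _) (fun k => ?_) (hc.add hc2)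
    simp only [norm_mul, Complex.norm_I, mul_one]
    nlinarith [mul_nonneg (norm_nonneg (c k)) (sq_nonneg (‖(n : ℂ) + 2 * k‖ - 1)),
      mul_nonneg (norm_nonneg (c k)) (norm_nonneg ((n : ℂ) + 2 * k))]
  have hd1 := hasDerivAt_tsum_mode hc hc1
  have hd2 := hasDerivAt_tsum_mode hc1 hc2
  have hcont1 := continuous_tsum_mode (n := n) hc1
  have hcont2 := continuous_tsum_mode (n := n) hc2
  refine ⟨fun x => ∑' k, c k * mode n k x, ?_,
    fun x => ∑' k : ℤ, ((n : ℂ) + 2 * k) * Complex.I * c k * mode n k x, _,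
    memLp_two_of_continuousOn_Icc hcont2.continuousOn, fun x _ => ?_, fun x _ => ?_, ?_, ?_, ?_⟩
  · by_contra! h0
    refine hne (funext fun k => ?_)
    have h3 := hillCoeff_tsum_mode (n := n) hc k
    rw [hillCoeff, intervalIntegral.integral_congr (g := fun _ => 0) fun x hx => by
      rw [Set.uIcc_of_le Real.pi_pos.le] at hx
      simp only [h0 x hx, zero_mul], intervalIntegral.integral_zero] at h3
    exact (mul_eq_zero.1 h3.symm).resolve_left (by exact_mod_cast Real.pi_ne_zero)
  · rw [intervalIntegral.integral_eq_sub_of_hasDerivAt (fun x _ => hd1 x)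
      (hcont1.intervalIntegrable _ _)]
    ring
  · rw [intervalIntegral.integral_eq_sub_of_hasDerivAt (fun x _ => hd2 x)
      (hcont2.intervalIntegrable _ _)]
    ring
  · rw [exp_boundary]
    simp only [mode_pi, mode_zero, mul_one]
    rw [tsum_mul_right, mul_comm]
  · rw [exp_boundary]
    simp only [mode_pi, mode_zero, mul_one]
    rw [tsum_mul_right, mul_comm]
  · refine Filter.Eventually.of_forall fun x => ?_
    have s0 := (summable_mul_mode (n := n) hc x).hasSum
    have sh : ∀ j : ℤ, Summable fun k => c (k + j) * mode n k x := fun j =>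
      summable_mul_mode (hs j) x
    have s1 := (Equiv.addRight (-1 : ℤ)).hasSum_iff.2 (sh 1).hasSum
    have s2 := (Equiv.addRight (1 : ℤ)).hasSum_iff.2 (sh (-1)).hasSum
    have h3 := (s0.mul_left (potential a x)).unique (by
      convert! (s1.add s2).mul_left a using 2 with k
      simp only [Function.comp, Equiv.coe_addRight, neg_add_cancel_right, add_neg_cancel_right]
      rw [← sub_eq_add_neg]
      linear_combination c k * potential_mul_mode n k a x)
    have h4 := (summable_mul_mode (n := n) hc2 x).hasSum.unique (by
      convert! (((sh (-1)).hasSum.add (sh 1).hasSum).mul_left a).sub (s0.mul_left l) using 2 with k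
      rw [h2]
      ring)
    dsimp only
    rw [h3, h4]
    ring

/-! ### The eigenvalue pair for imaginary parameters -/

theorem norm_lt_two_of_mem_imagSegment {a : ℂ} (ha : a ∈ imagSegment 2) : ‖a‖ < 2 := by
  obtain ⟨x, h0, h2, rfl⟩ := ha
  rw [norm_mul, Complex.norm_I, one_mul, Complex.norm_real, Real.norm_of_nonneg h0.le]
  exact h2

theorem ne_zero_of_mem_imagSegment {c : ℝ} {a : ℂ} (ha : a ∈ imagSegment c) : a ≠ 0 := by
  obtain ⟨x, h0, -, rfl⟩ := ha
  exact mul_ne_zero Complex.I_ne_zero (by exact_mod_cast h0.ne')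

theorem conj_of_mem_imagSegment {c : ℝ} {a : ℂ} (ha : a ∈ imagSegment c) :
    (starRingEnd ℂ) a = -a := by
  obtain ⟨x, -, -, rfl⟩ := ha
  simp

theorem IsHillSolution.isEigenvalue {n : ℕ} {a l σ : ℂ} {c : ℤ → ℂ}
    (hc : IsHillSolution n a l σ c) : IsEigenvalue (if Even n then 0 else Real.pi) a l :=
  isEigenvalue_of_solution hc.summable hc.all fun h => by simpa [h] using hc.zero

/-- In the disc there are one eigenvalue with an even and one with an odd eigenfunction. -/
theorem exists_eigenvaluesInDisc_eq {n : ℕ} (hn : 1 ≤ n) (hn2 : n ≠ 2) {a : ℂ}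
    (ha : a ∈ imagSegment 2) : ∃ p q : ℂ, p ≠ q ∧ eigenvaluesInDisc n a = {p, q} ∧
      ((Even n ∧ p.im = 0 ∧ q.im = 0) ∨ (¬Even n ∧ q = (starRingEnd ℂ) p)) := by
  have ha2 := norm_lt_two_of_mem_imagSegment ha
  have ha0 := ne_zero_of_mem_imagSegment ha
  have hconj := conj_of_mem_imagSegment ha
  have hdisc : ∀ {l : ℂ}, ‖l - (n : ℂ) ^ 2‖ ≤ 4 → ‖(starRingEnd ℂ) l - (n : ℂ) ^ 2‖ ≤ 4 := by
    intro l hl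
    rwa [← Complex.norm_conj, map_sub, Complex.conj_conj, map_pow, Complex.conj_natCast]
  obtain ⟨p, ⟨hp, c, hc⟩, hpu⟩ := existsUnique_hillSolution hn hn2 (σ := 1) ha2 (by norm_num)
  obtain ⟨q, ⟨hq, e, he⟩, hqu⟩ := existsUnique_hillSolution hn hn2 (σ := -1) ha2 (by norm_num)
  have hc' := hc.conj hconj (by simp)
  have he' := he.conj hconj (by simp)
  refine ⟨p, q, ?_, ?_, ?_⟩
  · rintro rfl
    exact not_hillSolution_both ha0 hc he
  · ext l
    simp only [eigenvaluesInDisc, Set.mem_ofPred_eq, Set.mem_insert_iff, Set.mem_singleton_iff,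
      Metric.mem_closedBall, dist_eq_norm]
    constructor
    · rintro ⟨h, hl⟩
      obtain ⟨u, ⟨M, hM⟩, hu, hu0⟩ := h.exists_solution
      rcases exists_hillSolution_of_bounded hn hn2 ha2 hl hM hu hu0 with h | h
      · exact Or.inl (hpu l ⟨hl, h⟩)
      · exact Or.inr (hqu l ⟨hl, h⟩)
    · rintro (rfl | rfl)
      · exact ⟨hc.isEigenvalue, hp⟩
      · exact ⟨he.isEigenvalue, hq⟩
  -- Conjugation preserves the parity class for even `n` and exchanges the classes for odd `n`;
  -- uniqueness in each class identifies the conjugates.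
  · by_cases hpar : Even n
    · rw [hpar.neg_one_pow, one_mul] at hc' he'
      exact Or.inl ⟨hpar, Complex.conj_eq_iff_im.1 (hpu _ ⟨hdisc hp, _, hc'⟩),
        Complex.conj_eq_iff_im.1 (hqu _ ⟨hdisc hq, _, he'⟩)⟩
    · rw [(Nat.not_even_iff_odd.1 hpar).neg_one_pow, mul_one] at hc'
      exact Or.inr ⟨hpar, (hqu _ ⟨hdisc hp, _, hc'⟩).symm⟩

theorem exists_isEigenPair {n : ℕ} (hn : 1 ≤ n) (hn2 : n ≠ 2) {a : ℂ} (ha : a ∈ imagSegment 2) :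
    ∃ p : ℂ × ℂ, IsEigenPair n a p ∧
      (Even n ∧ p.1.im = 0 ∧ p.2.im = 0 ∨ ¬Even n ∧ p.1.im ≠ 0 ∧ p.2.im ≠ 0) := by
  obtain ⟨p, q, hpq, hset, ⟨hpar, hp, hq⟩ | ⟨hpar, rfl⟩⟩ := exists_eigenvaluesInDisc_eq hn hn2 ha
  · have hre : p.re ≠ q.re := fun h => hpq (Complex.ext h (hp.trans hq.symm))
    rcases lt_or_gt_of_ne hre with h | h
    · exact ⟨(p, q), ⟨hset, Or.inl ⟨hp, hq, h⟩⟩, Or.inl ⟨hpar, hp, hq⟩⟩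
    · exact ⟨(q, p), ⟨hset.trans (Set.pair_comm _ _), Or.inl ⟨hq, hp, h⟩⟩, Or.inl ⟨hpar, hq, hp⟩⟩
  · have him : p.im ≠ 0 := fun h => hpq (Complex.conj_eq_iff_im.2 h).symm
    rcases lt_or_gt_of_ne him with h | h
    · exact ⟨(p, (starRingEnd ℂ) p), ⟨hset, Or.inr ⟨h, by simpa using h, rfl⟩⟩,
        Or.inr ⟨hpar, him, by simpa using him⟩⟩
    · exact ⟨((starRingEnd ℂ) p, p), ⟨hset.trans (Set.pair_comm _ _),
        Or.inr ⟨by simpa using h, h, by simp⟩⟩, Or.inr ⟨hpar, by simpa using him, him⟩⟩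

/-- The eigenvalues are real for even `n` and nonreal for odd `n`. -/
theorem eigenPair_spec {n : ℕ} (hn : 1 ≤ n) (hn2 : n ≠ 2) {a : ℂ} (ha : a ∈ imagSegment 2) :
    IsEigenPair n a (lamMinus n a, lamPlus n a) ∧
      ((lamMinus n a).im = 0 ↔ Even n) ∧ ((lamPlus n a).im = 0 ↔ Even n) := by
  obtain ⟨p, hp, h⟩ := exists_isEigenPair hn hn2 ha
  have hspec : IsEigenPair n a (eigenPair n a) := Classical.epsilon_spec ⟨p, hp⟩
  refine ⟨hspec, ?_⟩
  rw [lamMinus, lamPlus, hspec.unique hp]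
  tauto

theorem imagSegment_two_nonempty : (imagSegment 2).Nonempty :=
  ⟨Complex.I * (1 : ℝ), 1, by norm_num, by norm_num, rfl⟩

theorem forall_iff_exists_of_forall_iff {α : Type*} {s : Set α} (hs : s.Nonempty) {P : α → Prop}
    {Q : Prop} (h : ∀ x ∈ s, P x ↔ Q) : (∀ x ∈ s, P x) ↔ ∃ x ∈ s, P x := by
  obtain ⟨x₀, hx₀⟩ := hs
  refine ⟨fun hP => ⟨x₀, hx₀, hP x₀ hx₀⟩, ?_⟩
  rintro ⟨x, hx, hP⟩ z hz
  exact (h z hz).2 ((h x hx).1 hP)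

end MathieuOp

end

theorem theorem2 (n : ℕ) (hn : 1 ≤ n) (hn2 : n ≠ 2) :
    -- the two eigenvalues exist and are as their notation says
    (∀ a ∈ MathieuOp.imagSegment 2,
      MathieuOp.IsEigenPair n a (MathieuOp.lamMinus n a, MathieuOp.lamPlus n a)) ∧
    ((∀ a ∈ MathieuOp.imagSegment 2, (MathieuOp.lamMinus n a).im = 0) ↔
      ∃ b ∈ MathieuOp.imagSegment 2, (MathieuOp.lamMinus n b).im = 0) ∧
    ((∀ a ∈ MathieuOp.imagSegment 2, (MathieuOp.lamMinus n a).im ≠ 0) ↔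
      ∃ b ∈ MathieuOp.imagSegment 2, (MathieuOp.lamMinus n b).im ≠ 0) ∧
    ((∀ a ∈ MathieuOp.imagSegment 2, (MathieuOp.lamPlus n a).im = 0) ↔
      ∃ b ∈ MathieuOp.imagSegment 2, (MathieuOp.lamPlus n b).im = 0) ∧
    ((∀ a ∈ MathieuOp.imagSegment 2, (MathieuOp.lamPlus n a).im ≠ 0) ↔
      ∃ b ∈ MathieuOp.imagSegment 2, (MathieuOp.lamPlus n b).im ≠ 0) := by
  have hm := fun a (ha : a ∈ MathieuOp.imagSegment 2) => (MathieuOp.eigenPair_spec hn hn2 ha).2.1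
  have hp := fun a (ha : a ∈ MathieuOp.imagSegment 2) => (MathieuOp.eigenPair_spec hn hn2 ha).2.2
  have hne := MathieuOp.imagSegment_two_nonempty
  exact ⟨fun a ha => (MathieuOp.eigenPair_spec hn hn2 ha).1,
    MathieuOp.forall_iff_exists_of_forall_iff hne hm,
    MathieuOp.forall_iff_exists_of_forall_iff hne fun a ha => not_congr (hm a ha),
    MathieuOp.forall_iff_exists_of_forall_iff hne hp,
    MathieuOp.forall_iff_exists_of_forall_iff hne fun a ha => not_congr (hp a ha)⟩
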